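/- Let $G^s=(V^s,E^s)$ be a finite directed graph (a social network) in which each link $(u,v)\in E^s$ has a propagation probability $p(u,v)\in[0,1]$ and each node $v\in V^s$ has a criticality value $cr_v\ge 0$, with $\Omega=\sum_{v\in V^s}cr_v>0$. Let $n=|V^s|$, let $1\le k\le n$, $\epsilon>0$, $0<\delta<1$, and put $$\tau=\sqrt{\ln\tfrac2\delta},\qquad \sigma=\sqrt{\left(1-\tfrac1e\right)\left(\ln\tbinom nk+\ln\tfrac2\delta\right)},\qquad \phi=\frac{(1-1/e)\,\sigma+\tau}{\epsilon},\qquad \gamma=2\left(\phi^2+\ln\tfrac2\delta\right).$$ A random RR (reverse reachable) set is generated as follows: draw an origin node, the node $v$ with probability $cr_v/\Omega$; starting from the origin, search backwards along the links, where each link $(u,v)$ into a node $v$ that has been found is examined once and is live with probability $p(u,v)$, independently of everything else; the RR set consists of the nodes found, that is, those that reach the origin along live links. For a collection $\mathcal R$ of RR sets and a set $S$ of nodes, $\deg_{\mathcal R}(S)$ is the number of members of $\mathcal R$ that contain a node of $S$. The algorithm Targeted-IM starts with $\mathcal R=\emptyset$, $\bar S=\emptyset$, $N_R^0=1$, $N_R=\gamma$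 and, while $\deg_{\mathcal R}(\bar S)<\gamma$, repeats: for $i=N_R^0,N_R^0+1,\dots$ up to $N_R$, generate a new independent RR set and add it to $\mathcal R$ (counted with multiplicity); let $\bar S$ be the result of greedy maximum coverage on $\mathcal R$ (up to $k$ times, choose a node that lies in the greatest positive number of members of $\mathcal R$ not yet covered; implemented with incidence lists and degree buckets); set $N_R^0=N_R$ and then $N_R=2N_R$. Finally it returns $\bar S$. The running time is the number of elementary operations of a unit-cost random access machine, where the drawing of an origin and the flip of a coin cost one operation each, plus $n$ operations for the initialization; the graph is given by in-adjacency lists. Then, for networks with $|V^s|=O(|E^s|)$, the expected running time of Targeted-IM is $O(\gamma|E^s|)$: for every real $a$ there is a constant $C$, depending on $a$ only, such that for all such $G^s,p,cr,k,\epsilon,\delta$ with $|V^s|\le a|E^s|$ the expected running time is at most $C\,\gamma\,|E^s|$. -/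

import Mathlib

open MeasureTheory ProbabilityTheory
open scoped ENNReal NNReal

namespace TargetedIM

/-! ### Step-counted computations (unit-cost random access machine) -/

/-- A result together with the number of elementary operations spent on computing it.  One
elementary operation stands for a bounded amount of work of a random access machine: moving one
step along a list, a bounded number of reads and writes of array cells, a bounded number of
arithmetic operations and comparisons, the drawing of one origin node, or the flip of one coin.
Arrays are written as functions on their index set, `Function.update` being the write to a cell. -/
structure Timed (α : Type) where
  val : α
  cost : ℕ

instance : Monad Timed where
  pure a := ⟨a, 0⟩
  bind x f := ⟨(f x.val).val, x.cost + (f x.val).cost⟩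

/-- Spend `c` elementary operations. -/
def tick (c : ℕ) : Timed Unit := ⟨(), c⟩

/-! ### The social network and its random draws -/

/-- A social network on the users `0, …, n - 1`: directed links `(u, v)`, a propagation probability
of each link (the values of `prob` off the links are never used), and nonnegative criticality values
of the users, not all of them zero. -/
structure SocialNetwork (n : ℕ) where
  links : Finset (Fin n × Fin n)
  prob : Fin n → Fin n → unitInterval
  cr : Fin n → ℝ≥0
  exists_critical : ∃ v, cr v ≠ 0

/-- The list of the in-neighbours of `v`; the network is given to the algorithm by these
adjacency lists. -/
def SocialNetwork.inList {n : ℕ} (G : SocialNetwork n) (v : Fin n) : List (Fin n) :=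
  (List.finRange n).filter fun u => (u, v) ∈ G.links

/-- The total criticality `Ω`. -/
noncomputable def SocialNetwork.totalCr {n : ℕ} (G : SocialNetwork n) : ℝ≥0 := ∑ v, G.cr v

lemma SocialNetwork.sum_cr_div {n : ℕ} (G : SocialNetwork n) :
    ∑ v, ((G.cr v / G.totalCr : ℝ≥0) : ℝ≥0∞) = 1 := by
  have h : G.totalCr ≠ 0 := by
    obtain ⟨v, hv⟩ := G.exists_critical
    intro h0
    exact hv (Finset.sum_eq_zero_iff.mp h0 v (Finset.mem_univ v))
  rw [← ENNReal.ofNNReal_finsetSum, ← Finset.sum_div]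
  change (((G.totalCr / G.totalCr : ℝ≥0)) : ℝ≥0∞) = 1
  rw [div_self h, ENNReal.coe_one]

/-- The law of the origin of a random RR set: the user `v` with probability `cr v / Ω`. -/
noncomputable def SocialNetwork.originLaw {n : ℕ} (G : SocialNetwork n) : PMF (Fin n) :=
  PMF.ofFintype (fun v => ((G.cr v / G.totalCr : ℝ≥0) : ℝ≥0∞)) G.sum_cr_div

/-- The randomness available to the generation of one RR set: an origin, and for each pair `(u, v)`
the coin that decides whether the link `(u, v)` is live in the sample graph. -/
abbrev Draw (n : ℕ) : Type := Fin n × (Fin n → Fin n → Bool)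

/-- The law of a draw: the origin follows `originLaw`, the coin of `(u, v)` shows `true` with
probability `prob u v`, and all of these are independent. -/
noncomputable def SocialNetwork.drawLaw {n : ℕ} (G : SocialNetwork n) : Measure (Draw n) :=
  G.originLaw.toMeasure.prod
    (Measure.pi fun u => Measure.pi fun v => bernoulliMeasure true false (G.prob u v))

instance {n : ℕ} (G : SocialNetwork n) : IsProbabilityMeasure G.drawLaw := by
  unfold SocialNetwork.drawLaw
  infer_instance

/-- The law of the random tape of the algorithm: the `i`-th entry is read when the `i`-th RR set is
generated, and the entries are independent draws. -/
noncomputable def SocialNetwork.tapeLaw {n : ℕ} (G : SocialNetwork n) : Measure (ℕ → Draw n) :=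
  Measure.infinitePi fun _ => G.drawLaw

/-! ### Generation of one RR set by reverse search from a random origin -/

/-- State of the reverse search: marks of the nodes found so far, found nodes whose in-links have
not been examined yet, and the list of all found nodes. -/
structure Search (n : ℕ) where
  mark : Fin n → Bool
  todo : List (Fin n)
  found : List (Fin n)

/-- Examine the links into `v` from the listed nodes. -/
def scanLinks {n : ℕ} (live : Fin n → Fin n → Bool) (v : Fin n) :
    List (Fin n) → Search n → Timed (Search n)
  | [], s => pure s
  | u :: us, s => do
      tick 1
      if live u v = true ∧ s.mark u = false then
        tick 1
        scanLinks live v us ⟨Function.update s.mark u true, u :: s.todo, u :: s.found⟩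
      else
        scanLinks live v us s

/-- Repeat: take a found node off `todo` and examine its in-links.  The first argument bounds the
number of repetitions; every node is taken at most once, so that the bound `n` is never the reason
to stop. -/
def explore {n : ℕ} (G : SocialNetwork n) (live : Fin n → Fin n → Bool) :
    ℕ → Search n → Timed (Search n)
  | 0, s => pure s
  | f + 1, s =>
      match s.todo with
      | [] => pure s
      | v :: vs => do
          tick 1
          let s' ← scanLinks live v (G.inList v) ⟨s.mark, vs, s.found⟩
          explore G live f s'

/-- Generate one RR set: the list of the nodes that reach the origin along live links.  One operation
is spent on the draw of the origin; at the end, the marks are erased. -/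
def generateRR {n : ℕ} (G : SocialNetwork n) (d : Draw n) : Timed (List (Fin n)) := do
  tick 1
  let s ← explore G d.2 n ⟨Function.update (fun _ => false) d.1 true, [d.1], [d.1]⟩
  tick s.found.length
  pure s.found

/-! ### Greedy maximum coverage -/

/-- For each node the number of RR sets that contain it and the list of (number of, pointer to)
these RR sets, and the list of the nodes that occur in some RR set. -/
structure Incidence (n : ℕ) where
  deg : Fin n → ℕ
  sets : Fin n → List (ℕ × List (Fin n))
  touched : List (Fin n)

/-- Enter the RR set `R`, which has number `i`, at the listed nodes. -/
def indexSet {n : ℕ} (i : ℕ) (R : List (Fin n)) :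
    List (Fin n) → Incidence n → Timed (Incidence n)
  | [], x => pure x
  | v :: vs, x => do
      tick 1
      indexSet i R vs
        ⟨Function.update x.deg v (x.deg v + 1), Function.update x.sets v ((i, R) :: x.sets v),
          if x.deg v = 0 then v :: x.touched else x.touched⟩

/-- Enter all listed RR sets, numbered from `i` on. -/
def indexAll {n : ℕ} : ℕ → List (List (Fin n)) → Incidence n → Timed (Incidence n)
  | _, [], x => pure x
  | i, R :: Rs, x => do
      tick 1
      let x' ← indexSet i R R x
      indexAll (i + 1) Rs x'

/-- Put each listed node `v` into the bucket number `deg v`. -/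
def fillBuckets {n : ℕ} (deg : Fin n → ℕ) :
    List (Fin n) → (ℕ → List (Fin n)) → Timed (ℕ → List (Fin n))
  | [], b => pure b
  | v :: vs, b => do
      tick 1
      fillBuckets deg vs (Function.update b (deg v) (v :: b (deg v)))

/-- State of the greedy selection: `deg v` is the number of RR sets not yet covered that contain `v`;
`covered` flags the covered RR sets, by their numbers; `bucket` sorts the nodes by their degrees at
the time of insertion; `left` more nodes may be chosen; `seeds` are the chosen nodes; and
`gain` is the number of covered RR sets. -/
structure Greedy (n : ℕ) where
  deg : Fin n → ℕ
  covered : ℕ → Bool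
  bucket : ℕ → List (Fin n)
  left : ℕ
  seeds : List (Fin n)
  gain : ℕ

/-- Decrease the degrees of the listed nodes by one. -/
def lowerDegrees {n : ℕ} : List (Fin n) → (Fin n → ℕ) → Timed (Fin n → ℕ)
  | [], deg => pure deg
  | u :: us, deg => do
      tick 1
      lowerDegrees us (Function.update deg u (deg u - 1))

/-- Cover those of the listed RR sets that are not yet covered. -/
def coverSets {n : ℕ} : List (ℕ × List (Fin n)) → Greedy n → Timed (Greedy n)
  | [], s => pure s
  | (i, R) :: rest, s => do
      tick 1
      if s.covered i = true then
        coverSets rest s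
      else
        let deg' ← lowerDegrees R s.deg
        coverSets rest
          ⟨deg', Function.update s.covered i true, s.bucket, s.left, s.seeds, s.gain + 1⟩

/-- Go through the listed nodes, which form the bucket number `d`: a node that still has degree `d`
is chosen, any other node is moved to the bucket of its present degree. -/
def serveBucket {n : ℕ} (sets : Fin n → List (ℕ × List (Fin n))) (d : ℕ) :
    List (Fin n) → Greedy n → Timed (Greedy n)
  | [], s => pure s
  | v :: vs, s => do
      tick 1
      if s.left = 0 then
        pure s
      else if s.deg v = d then
        let s' ← coverSets (sets v)
          ⟨s.deg, s.covered, s.bucket, s.left - 1, v :: s.seeds, s.gain⟩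
        serveBucket sets d vs s'
      else
        serveBucket sets d vs
          ⟨s.deg, s.covered, Function.update s.bucket (s.deg v) (v :: s.bucket (s.deg v)),
            s.left, s.seeds, s.gain⟩

/-- Serve the buckets number `d, d - 1, …, 1`, in this order. -/
def serveBuckets {n : ℕ} (sets : Fin n → List (ℕ × List (Fin n))) :
    ℕ → Greedy n → Timed (Greedy n)
  | 0, s => pure s
  | d + 1, s => do
      tick 1
      let s' ← serveBucket sets (d + 1) (s.bucket (d + 1)) s
      serveBuckets sets d s'

/-- Greedy maximum coverage: up to `k` times, choose a node that lies in the greatest (positive)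
number of RR sets not yet covered.  Returns the chosen nodes and the number of RR sets that they
cover.  At the end, the used cells of the arrays are erased. -/
def greedyMC {n : ℕ} (k : ℕ) (RR : List (List (Fin n))) : Timed (List (Fin n) × ℕ) := do
  tick 1
  let x ← indexAll 0 RR ⟨fun _ => 0, fun _ => [], []⟩
  let b ← fillBuckets x.deg x.touched (fun _ => [])
  let s ← serveBuckets x.sets RR.length ⟨x.deg, fun _ => false, b, k, [], 0⟩
  tick (RR.length + x.touched.length)
  pure (s.seeds, s.gain)

/-! ### The algorithm Targeted-IM -/

/-- State of the main loop: the collection of the RR sets, the check points `N_R⁰` and `N_R`, the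
present seed set, and the number of RR sets that it covers. -/
structure Main (n : ℕ) where
  RR : List (List (Fin n))
  lo : ℝ
  hi : ℝ
  seeds : List (Fin n)
  deg : ℕ

/-- Generate `c` further RR sets and add them to the collection. -/
def generateMany {n : ℕ} (G : SocialNetwork n) (tape : ℕ → Draw n) :
    ℕ → List (List (Fin n)) → Timed (List (List (Fin n)))
  | 0, RR => pure RR
  | c + 1, RR => do
      tick 1
      let R ← generateRR G (tape RR.length)
      generateMany G tape c (R :: RR)

/-- The body of the main loop.  The loop `for i = lo to hi`, with the values
`lo, lo + 1, lo + 2, … ≤ hi` of `i`, is run `⌊hi - lo⌋ + 1` times. -/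
noncomputable def mainBody {n : ℕ} (G : SocialNetwork n) (k : ℕ) (tape : ℕ → Draw n)
    (s : Main n) : Timed (Main n) := do
  let RR ← generateMany G tape (⌊s.hi - s.lo⌋₊ + 1) s.RR
  let out ← greedyMC k RR
  tick 1
  pure ⟨RR, s.hi, 2 * s.hi, out.1, out.2⟩

open Classical in
/-- The main loop `while deg < γ`, cut off after the given number of rounds. -/
noncomputable def mainLoop {n : ℕ} (G : SocialNetwork n) (k : ℕ) (γ : ℝ) (tape : ℕ → Draw n) :
    ℕ → Main n → Timed (Main n)
  | 0, s => pure s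
  | f + 1, s => do
      tick 1
      if (s.deg : ℝ) < γ then
        let s' ← mainBody G k tape s
        mainLoop G k γ tape f s'
      else
        pure s

/-- The algorithm, cut off after the given number of rounds of the main loop.  The first `n`
operations read the criticality values, prepare the drawing of origins and initialize the
arrays. -/
noncomputable def targetedIM {n : ℕ} (G : SocialNetwork n) (k : ℕ) (γ : ℝ) (tape : ℕ → Draw n)
    (rounds : ℕ) : Timed (Main n) := do
  tick n
  mainLoop G k γ tape rounds ⟨[], 1, γ, [], 0⟩

/-- The running time on a given tape: the number of operations of the run that is not cut off
(infinite if the main loop does not end). -/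
noncomputable def runningTime {n : ℕ} (G : SocialNetwork n) (k : ℕ) (γ : ℝ)
    (tape : ℕ → Draw n) : ℝ≥0∞ :=
  ⨆ rounds : ℕ, ((targetedIM G k γ tape rounds).cost : ℝ≥0∞)

/-- The expected running time. -/
noncomputable def expectedRunningTime {n : ℕ} (G : SocialNetwork n) (k : ℕ) (γ : ℝ) : ℝ≥0∞ :=
  ∫⁻ tape, runningTime G k γ tape ∂G.tapeLaw

/-! ### The stopping threshold -/

noncomputable def tau (δ : ℝ) : ℝ := √(Real.log (2 / δ))

noncomputable def sigma (n k : ℕ) (δ : ℝ) : ℝ :=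
  √((1 - 1 / Real.exp 1) * (Real.log (n.choose k) + Real.log (2 / δ)))

noncomputable def phi (n k : ℕ) (ε δ : ℝ) : ℝ :=
  ((1 - 1 / Real.exp 1) * sigma n k δ + tau δ) / ε

/-- The stopping threshold `γ = 2 (φ² + log (2 / δ))`. -/
noncomputable def threshold (n k : ℕ) (ε δ : ℝ) : ℝ :=
  2 * (phi n k ε δ ^ 2 + Real.log (2 / δ))

end TargetedIM

namespace TargetedIM

@[simp] lemma Timed.val_pure {α : Type} (a : α) : (pure a : Timed α).val = a := rfl

@[simp] lemma Timed.cost_pure {α : Type} (a : α) : (pure a : Timed α).cost = 0 := rfl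

@[simp] lemma Timed.val_bind {α β : Type} (x : Timed α) (f : α → Timed β) :
    (x >>= f).val = (f x.val).val := rfl

@[simp] lemma Timed.cost_bind {α β : Type} (x : Timed α) (f : α → Timed β) :
    (x >>= f).cost = x.cost + (f x.val).cost := rfl

@[simp] lemma cost_tick (c : ℕ) : (tick c).cost = c := rfl

/-! ### The reverse search -/

section Search

variable {n : ℕ}

/-- The found nodes are listed once each, and all of them are marked. -/
def Search.WellFormed (s : Search n) : Prop :=
  s.found.Nodup ∧ ∀ u ∈ s.found, s.mark u = true

lemma wellFormed_scanLinks (live : Fin n → Fin n → Bool) (v : Fin n) (us : List (Fin n))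
    (s : Search n) (hs : s.WellFormed) : (scanLinks live v us s).val.WellFormed := by
  induction us generalizing s with
  | nil => exact hs
  | cons u us ih =>
    rw [scanLinks]
    split_ifs with h
    · refine ih _ ⟨List.nodup_cons.2 ⟨fun hu => ?_, hs.1⟩, fun x hx => ?_⟩
      · have := hs.2 u hu
        simp_all
      · by_cases hxu : x = u
        · simp [hxu]
        · simpa [hxu] using hs.2 x (by simpa [hxu] using hx)
    · exact ih s hs

lemma cost_scanLinks (live : Fin n → Fin n → Bool) (v : Fin n) (us : List (Fin n))
    (s : Search n) :
    (scanLinks live v us s).cost + s.found.length =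
      us.length + (scanLinks live v us s).val.found.length := by
  induction us generalizing s with
  | nil => simp [scanLinks]
  | cons u us ih =>
    rw [scanLinks]
    split_ifs with h
    · have := ih ⟨Function.update s.mark u true, u :: s.todo, u :: s.found⟩
      simp at this ⊢
      omega
    · have := ih s
      simp at this ⊢
      omega

lemma sum_found_scanLinks (wt : Fin n → ℕ) (live : Fin n → Fin n → Bool) (v : Fin n)
    (us : List (Fin n)) (s : Search n) :
    ((scanLinks live v us s).val.found.map wt).sum + (s.todo.map wt).sum =
      (s.found.map wt).sum + ((scanLinks live v us s).val.todo.map wt).sum := by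
  induction us generalizing s with
  | nil => simp [scanLinks]
  | cons u us ih =>
    rw [scanLinks]
    split_ifs with h
    · have := ih ⟨Function.update s.mark u true, u :: s.todo, u :: s.found⟩
      simp at this ⊢
      omega
    · have := ih s
      simp at this ⊢
      omega

lemma wellFormed_explore (G : SocialNetwork n) (live : Fin n → Fin n → Bool) (f : ℕ)
    (s : Search n) (hs : s.WellFormed) : (explore G live f s).val.WellFormed := by
  induction f generalizing s with
  | zero => exact hs
  | succ f ih =>
    obtain ⟨mark, todo, found⟩ := s
    cases todo with
    | nil => exact hs
    | cons v vs => exact ih _ (wellFormed_scanLinks live v _ ⟨mark, vs, found⟩ hs)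

lemma cost_explore (G : SocialNetwork n) (live : Fin n → Fin n → Bool) (f : ℕ) (s : Search n) :
    (explore G live f s).cost + s.found.length +
        (s.found.map fun v => 1 + (G.inList v).length).sum ≤
      (explore G live f s).val.found.length +
        ((explore G live f s).val.found.map fun v => 1 + (G.inList v).length).sum +
        (s.todo.map fun v => 1 + (G.inList v).length).sum := by
  induction f generalizing s with
  | zero => simp [explore]
  | succ f ih =>
    obtain ⟨mark, todo, found⟩ := s
    cases todo with
    | nil => simp [explore]
    | cons v vs =>
      have h1 := cost_scanLinks live v (G.inList v) ⟨mark, vs, found⟩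
      have h2 := sum_found_scanLinks (fun v => 1 + (G.inList v).length) live v (G.inList v)
        ⟨mark, vs, found⟩
      have h3 := ih (scanLinks live v (G.inList v) ⟨mark, vs, found⟩).val
      simp only [explore, Timed.cost_bind, Timed.val_bind, cost_tick, List.map_cons,
        List.sum_cons] at h1 h2 h3 ⊢
      omega

lemma nodup_generateRR (G : SocialNetwork n) (d : Draw n) : (generateRR G d).val.Nodup :=
  (wellFormed_explore G d.2 n ⟨Function.update (fun _ => false) d.1 true, [d.1], [d.1]⟩
    ⟨by simp, by simp⟩).1

/-- The work attributed to an RR set: its members and the links into them. -/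
def workload (G : SocialNetwork n) (d : Draw n) : ℕ :=
  ((generateRR G d).val.map fun v => 1 + (G.inList v).length).sum

lemma length_generateRR_le_workload (G : SocialNetwork n) (d : Draw n) :
    (generateRR G d).val.length ≤ workload G d := by
  have := List.length_le_sum_of_one_le ((generateRR G d).val.map fun v => 1 + (G.inList v).length)
    (by simp)
  rwa [List.length_map] at this

lemma cost_generateRR (G : SocialNetwork n) (d : Draw n) :
    (generateRR G d).cost ≤ 3 * workload G d := by
  have h := cost_explore G d.2 n ⟨Function.update (fun _ => false) d.1 true, [d.1], [d.1]⟩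
  have h2 := length_generateRR_le_workload G d
  simp only [generateRR, workload, Timed.cost_bind, Timed.val_bind, cost_tick, Timed.val_pure,
    Timed.cost_pure, List.map_cons, List.map_nil, List.sum_cons, List.sum_nil,
    List.length_cons, List.length_nil] at h h2 ⊢
  omega

lemma found_scanLinks_ne_nil (live : Fin n → Fin n → Bool) (v : Fin n) (us : List (Fin n))
    (s : Search n) (hs : s.found ≠ []) : (scanLinks live v us s).val.found ≠ [] := by
  induction us generalizing s with
  | nil => exact hs
  | cons u us ih =>
    rw [scanLinks]
    split_ifs with h
    · exact ih _ (List.cons_ne_nil _ _)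
    · exact ih s hs

lemma found_explore_ne_nil (G : SocialNetwork n) (live : Fin n → Fin n → Bool) (f : ℕ)
    (s : Search n) (hs : s.found ≠ []) : (explore G live f s).val.found ≠ [] := by
  induction f generalizing s with
  | zero => exact hs
  | succ f ih =>
    obtain ⟨mark, todo, found⟩ := s
    cases todo with
    | nil => exact hs
    | cons v vs => exact ih _ (found_scanLinks_ne_nil live v _ ⟨mark, vs, found⟩ hs)

lemma one_le_workload (G : SocialNetwork n) (d : Draw n) : 1 ≤ workload G d :=
  (List.length_pos_iff.2 (found_explore_ne_nil G d.2 n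
    ⟨Function.update (fun _ => false) d.1 true, [d.1], [d.1]⟩ (List.cons_ne_nil _ _))).trans_le
    (length_generateRR_le_workload G d)

lemma sum_length_inList (G : SocialNetwork n) :
    ∑ v, (G.inList v).length = G.links.card := by
  have h : ∀ v, (G.inList v).length = (G.links.filter fun e => e.2 = v).card := by
    intro v
    have h1 : (G.inList v).length = (Finset.univ.filter fun u => (u, v) ∈ G.links).card := by
      rw [SocialNetwork.inList, ← List.toFinset_card_of_nodup ((List.nodup_finRange n).filter _)]
      congr 1
      ext u
      simp
    rw [h1]
    refine Finset.card_bij (fun u _ => (u, v)) ?_ ?_ ?_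
    · simp
    · simp
    · rintro ⟨u, v'⟩ h
      simp only [Finset.mem_filter] at h
      obtain ⟨h, rfl⟩ := h
      exact ⟨u, by simpa using h, rfl⟩
  simp_rw [h]
  exact (Finset.card_eq_sum_card_fiberwise fun _ _ => Finset.mem_coe.2 (Finset.mem_univ _)).symm

lemma workload_eq_sum (G : SocialNetwork n) (d : Draw n) :
    workload G d =
      ∑ v, if v ∈ (generateRR G d).val then 1 + (G.inList v).length else 0 := by
  rw [workload, ← List.sum_toFinset _ (nodup_generateRR G d), ← Finset.sum_filter]
  congr 1
  ext v
  simp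

end Search

/-! ### Greedy maximum coverage -/

section Greedy

variable {n : ℕ}

/-- What building the incidence lists of the RR sets number `0, …, L - 1`, whose sizes are given by
`len` and sum up to `T`, maintains. -/
structure Incidence.WellFormed (x : Incidence n) (len : ℕ → ℕ) (L T : ℕ) : Prop where
  length_sets : ∀ v, (x.sets v).length = x.deg v
  nodup : x.touched.Nodup
  mem_touched : ∀ v, v ∈ x.touched ↔ x.deg v ≠ 0
  sum_deg : ∑ v, x.deg v = T
  sets_spec : ∀ v, ∀ e ∈ x.sets v, e.1 < L ∧ e.2.length = len e.1

lemma cost_indexSet (i : ℕ) (R vs : List (Fin n)) (x : Incidence n) :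
    (indexSet i R vs x).cost = vs.length := by
  induction vs generalizing x with
  | nil => rfl
  | cons v vs ih =>
    rw [indexSet]
    simp [ih]
    omega

lemma wellFormed_indexSet {len : ℕ → ℕ} {L T : ℕ} {i : ℕ} {R : List (Fin n)} (hi : i < L)
    (hR : R.length = len i) (vs : List (Fin n)) (x : Incidence n) (hx : x.WellFormed len L T) :
    (indexSet i R vs x).val.WellFormed len L (T + vs.length) := by
  induction vs generalizing x T with
  | nil => exact hx
  | cons v vs ih =>
    rw [indexSet]
    have : T + (v :: vs).length = (T + 1) + vs.length := by simp; omega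
    rw [this]
    refine ih _ ⟨fun u => ?_, ?_, fun u => ?_, ?_, fun u e he => ?_⟩
    · by_cases h : u = v
      · subst h
        simp [hx.length_sets]
      · simp [h, hx.length_sets]
    · by_cases h : x.deg v = 0
      · have : v ∉ x.touched := fun hv => (hx.mem_touched v).1 hv h
        simpa [h] using ⟨this, hx.nodup⟩
      · simpa [h] using hx.nodup
    · by_cases h : u = v
      · subst h
        by_cases h0 : x.deg u = 0
        · simp [h0]
        · simpa [h0] using (hx.mem_touched u).2 h0
      · by_cases h0 : x.deg v = 0
        · simp [h0, h, hx.mem_touched]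
        · simp [h0, h, hx.mem_touched]
    · rw [Finset.sum_update_of_mem (Finset.mem_univ v), ← hx.sum_deg,
        ← Finset.add_sum_erase _ _ (Finset.mem_univ v), Finset.sdiff_singleton_eq_erase]
      omega
    · by_cases h : u = v
      · subst h
        simp only [Function.update_self, List.mem_cons] at he
        rcases he with rfl | he
        · exact ⟨hi, hR⟩
        · exact hx.sets_spec u e he
      · simp only [Function.update_of_ne h] at he
        exact hx.sets_spec u e he

lemma cost_indexAll (i : ℕ) (RR : List (List (Fin n))) (x : Incidence n) :
    (indexAll i RR x).cost = RR.length + (RR.map List.length).sum := by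
  induction RR generalizing i x with
  | nil => rfl
  | cons R RR ih =>
    rw [indexAll]
    simp [ih, cost_indexSet]
    omega

lemma wellFormed_indexAll {len : ℕ → ℕ} {L T i : ℕ} (RR : List (List (Fin n)))
    (hi : i + RR.length ≤ L) (hlen : ∀ j (h : j < RR.length), (RR[j]).length = len (i + j))
    (x : Incidence n) (hx : x.WellFormed len L T) :
    (indexAll i RR x).val.WellFormed len L (T + (RR.map List.length).sum) := by
  induction RR generalizing i x T with
  | nil => exact hx
  | cons R RR ih =>
    rw [indexAll]
    simp only [List.length_cons] at hi
    have h1 := wellFormed_indexSet (L := L) (i := i) (R := R) (by omega)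
      (hlen 0 (Nat.succ_pos _)) R x hx
    have := ih (i := i + 1) (by omega) (fun j h => by
      have := hlen (j + 1) (by simpa using h)
      simp only [List.getElem_cons_succ] at this
      rw [this]
      congr 1
      omega) _ h1
    simpa [add_assoc] using this

lemma cost_fillBuckets (deg : Fin n → ℕ) (vs : List (Fin n)) (b : ℕ → List (Fin n)) :
    (fillBuckets deg vs b).cost = vs.length := by
  induction vs generalizing b with
  | nil => rfl
  | cons v vs ih =>
    rw [fillBuckets]
    simp [ih]
    omega

lemma mem_fillBuckets (deg : Fin n → ℕ) (vs : List (Fin n)) (b : ℕ → List (Fin n)) (d : ℕ)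
    (u : Fin n) :
    u ∈ (fillBuckets deg vs b).val d ↔ u ∈ b d ∨ (u ∈ vs ∧ deg u = d) := by
  induction vs generalizing b with
  | nil => simp [fillBuckets]
  | cons v vs ih =>
    rw [fillBuckets]
    simp only [Timed.val_bind, ih, List.mem_cons]
    by_cases h : d = deg v
    · subst h
      simp only [Function.update_self, List.mem_cons]
      constructor
      · rintro ((rfl | h) | h) <;> tauto
      · rintro (h | ⟨rfl | h, h'⟩) <;> tauto
    · simp only [Function.update_of_ne h]
      constructor
      · tauto
      · rintro (h | ⟨rfl | h, h'⟩)
        · tauto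
        · exact absurd h'.symm h
        · tauto

/-- Each node in the buckets `0, …, d` counts with the number of its RR sets plus the number of its
bucket. -/
def bucketPotential (sets : Fin n → List (ℕ × List (Fin n))) (b : ℕ → List (Fin n)) (d : ℕ) : ℕ :=
  ∑ j ∈ Finset.range (d + 1), ((b j).map fun v => (sets v).length + j).sum

lemma bucketPotential_succ (sets : Fin n → List (ℕ × List (Fin n))) (b : ℕ → List (Fin n))
    (d : ℕ) : bucketPotential sets b (d + 1) =
      bucketPotential sets b d + ((b (d + 1)).map fun v => (sets v).length + (d + 1)).sum :=
  Finset.sum_range_succ _ _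

lemma bucketPotential_update (sets : Fin n → List (ℕ × List (Fin n))) (b : ℕ → List (Fin n))
    (d j : ℕ) (v : Fin n) :
    bucketPotential sets (Function.update b j (v :: b j)) d ≤
      bucketPotential sets b d + ((sets v).length + j) := by
  unfold bucketPotential
  calc _ ≤ ∑ i ∈ Finset.range (d + 1), (((b i).map fun v => (sets v).length + i).sum +
        if i = j then (sets v).length + j else 0) := by
        refine Finset.sum_le_sum fun i _ => ?_
        by_cases h : i = j
        · subst h
          simp
          omega
        · simp [h]
    _ ≤ _ := by
        rw [Finset.sum_add_distrib, Finset.sum_ite_eq']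
        split_ifs <;> omega

lemma bucketPotential_fillBuckets (sets : Fin n → List (ℕ × List (Fin n))) (deg : Fin n → ℕ)
    (vs : List (Fin n)) (b : ℕ → List (Fin n)) (d : ℕ) :
    bucketPotential sets (fillBuckets deg vs b).val d ≤
      bucketPotential sets b d + (vs.map fun v => (sets v).length + deg v).sum := by
  induction vs generalizing b with
  | nil => simp [fillBuckets]
  | cons v vs ih =>
    rw [fillBuckets]
    have h1 := ih (Function.update b (deg v) (v :: b (deg v)))
    have h2 := bucketPotential_update sets b d (deg v) v
    simp only [Timed.val_bind, List.map_cons, List.sum_cons] at h1 h2 ⊢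
    omega

/-- The total size of those of the first `L` RR sets that are not covered. -/
def uncoveredSize (len : ℕ → ℕ) (L : ℕ) (covered : ℕ → Bool) : ℕ :=
  ∑ i ∈ Finset.range L, if covered i = true then 0 else len i

lemma uncoveredSize_update (len : ℕ → ℕ) {L : ℕ} (covered : ℕ → Bool) {i : ℕ} (hi : i < L)
    (h : covered i = false) :
    uncoveredSize len L (Function.update covered i true) + len i = uncoveredSize len L covered := by
  unfold uncoveredSize
  rw [← Finset.add_sum_erase _ _ (Finset.mem_range.2 hi),
    ← Finset.add_sum_erase (Finset.range L) (fun j => if covered j = true then 0 else len j)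
      (Finset.mem_range.2 hi)]
  have : ∀ j ∈ (Finset.range L).erase i,
      (if Function.update covered i true j = true then 0 else len j) =
        if covered j = true then 0 else len j := by
    intro j hj
    rw [Function.update_of_ne (Finset.ne_of_mem_erase hj)]
  rw [Finset.sum_congr rfl this]
  simp [h]
  omega

lemma cost_lowerDegrees (us : List (Fin n)) (deg : Fin n → ℕ) :
    (lowerDegrees us deg).cost = us.length := by
  induction us generalizing deg with
  | nil => rfl
  | cons u us ih =>
    rw [lowerDegrees]
    simp [ih]
    omega

lemma lowerDegrees_le (us : List (Fin n)) (deg : Fin n → ℕ) (v : Fin n) :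
    (lowerDegrees us deg).val v ≤ deg v := by
  induction us generalizing deg with
  | nil => exact le_rfl
  | cons u us ih =>
    rw [lowerDegrees]
    refine (ih _).trans ?_
    by_cases h : v = u
    · subst h
      simp
    · simp [h]

lemma bucket_coverSets (es : List (ℕ × List (Fin n))) (s : Greedy n) :
    (coverSets es s).val.bucket = s.bucket := by
  induction es generalizing s with
  | nil => rfl
  | cons e es ih =>
    obtain ⟨i, R⟩ := e
    rw [coverSets]
    split_ifs with h
    · exact ih s
    · exact ih _

lemma deg_coverSets_le (es : List (ℕ × List (Fin n))) (s : Greedy n) (v : Fin n) :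
    (coverSets es s).val.deg v ≤ s.deg v := by
  induction es generalizing s with
  | nil => exact le_rfl
  | cons e es ih =>
    obtain ⟨i, R⟩ := e
    rw [coverSets]
    split_ifs with h
    · exact ih s
    · exact (ih _).trans (lowerDegrees_le R s.deg v)

lemma gain_le_coverSets (es : List (ℕ × List (Fin n))) (s : Greedy n) :
    s.gain ≤ (coverSets es s).val.gain := by
  induction es generalizing s with
  | nil => exact le_rfl
  | cons e es ih =>
    obtain ⟨i, R⟩ := e
    rw [coverSets]
    split_ifs with h
    · exact ih s
    · exact (Nat.le_succ _).trans (ih ⟨(lowerDegrees R s.deg).val, Function.update s.covered i true,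
        s.bucket, s.left, s.seeds, s.gain + 1⟩)

/-- Sets with different numbers, none of them covered, all contribute to the gain. -/
lemma gain_coverSets (es : List (ℕ × List (Fin n))) (s : Greedy n)
    (hnd : (es.map Prod.fst).Nodup) (hs : ∀ e ∈ es, s.covered e.1 = false) :
    (coverSets es s).val.gain = s.gain + es.length := by
  induction es generalizing s with
  | nil => rfl
  | cons e es ih =>
    obtain ⟨i, R⟩ := e
    simp only [List.map_cons, List.nodup_cons] at hnd
    have hi : s.covered i = false := hs (i, R) List.mem_cons_self
    rw [coverSets]
    simp only [hi, Bool.false_eq_true, if_false, Timed.val_bind, List.length_cons]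
    rw [ih _ hnd.2]
    · simp
      omega
    · intro e he
      have hne : e.1 ≠ i := by
        rintro rfl
        exact hnd.1 (List.mem_map_of_mem he)
      simpa [hne] using hs e (List.mem_cons_of_mem _ he)

lemma cost_coverSets {len : ℕ → ℕ} {L : ℕ} (es : List (ℕ × List (Fin n)))
    (hes : ∀ e ∈ es, e.1 < L ∧ e.2.length = len e.1) (s : Greedy n) :
    (coverSets es s).cost + uncoveredSize len L (coverSets es s).val.covered ≤
      es.length + uncoveredSize len L s.covered := by
  induction es generalizing s with
  | nil => simp [coverSets]
  | cons e es ih =>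
    obtain ⟨i, R⟩ := e
    have hes' : ∀ e ∈ es, e.1 < L ∧ e.2.length = len e.1 :=
      fun e he => hes e (List.mem_cons_of_mem _ he)
    rw [coverSets]
    by_cases h : s.covered i = true
    · have := ih hes' s
      simp only [h, if_true, Timed.cost_bind, Timed.val_bind, cost_tick, List.length_cons]
      omega
    · have h0 := hes (i, R) List.mem_cons_self
      have h1 := ih hes' ⟨(lowerDegrees R s.deg).val, Function.update s.covered i true, s.bucket,
        s.left, s.seeds, s.gain + 1⟩
      have h2 := uncoveredSize_update len s.covered h0.1 (by simpa using h)
      have h3 := cost_lowerDegrees R s.deg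
      simp only [h, Bool.false_eq_true, if_false, Timed.cost_bind, Timed.val_bind, cost_tick,
        List.length_cons] at h0 h1 h2 ⊢
      omega

/-- No node has a degree above the number of its bucket. -/
def Greedy.Sorted (s : Greedy n) : Prop :=
  ∀ d, ∀ v ∈ s.bucket d, s.deg v ≤ d

lemma sorted_serveBucket (sets : Fin n → List (ℕ × List (Fin n))) (d : ℕ) (vs : List (Fin n))
    (s : Greedy n) (hs : s.Sorted) : (serveBucket sets d vs s).val.Sorted := by
  induction vs generalizing s with
  | nil => exact hs
  | cons v vs ih =>
    rw [serveBucket]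
    split_ifs with h1 h2
    · exact hs
    · refine ih _ fun j u hu => ?_
      simp only [bucket_coverSets] at hu
      exact (deg_coverSets_le _ _ u).trans (hs j u hu)
    · refine ih _ fun j u hu => ?_
      by_cases hj : j = s.deg v
      · subst hj
        simp only [Function.update_self, List.mem_cons] at hu
        rcases hu with rfl | hu
        · exact le_rfl
        · exact hs _ u hu
      · simp only [Function.update_of_ne hj] at hu
        exact hs j u hu

lemma cost_serveBucket {sets : Fin n → List (ℕ × List (Fin n))} {len : ℕ → ℕ} {L : ℕ}
    (hsets : ∀ v, ∀ e ∈ sets v, e.1 < L ∧ e.2.length = len e.1) (d : ℕ) (vs : List (Fin n))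
    (s : Greedy n) (hs : ∀ v ∈ vs, s.deg v ≤ d + 1) :
    (serveBucket sets (d + 1) vs s).cost +
        bucketPotential sets (serveBucket sets (d + 1) vs s).val.bucket d +
        uncoveredSize len L (serveBucket sets (d + 1) vs s).val.covered ≤
      (vs.map fun v => (sets v).length + (d + 1)).sum + bucketPotential sets s.bucket d +
        uncoveredSize len L s.covered := by
  induction vs generalizing s with
  | nil => simp [serveBucket]
  | cons v vs ih =>
    rw [serveBucket]
    by_cases h1 : s.left = 0
    · simp only [h1, if_true, Timed.cost_bind, Timed.val_bind, cost_tick, Timed.cost_pure,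
        Timed.val_pure, List.map_cons, List.sum_cons]
      omega
    by_cases h2 : s.deg v = d + 1
    · have h3 := cost_coverSets (sets v) (hsets v)
        ⟨s.deg, s.covered, s.bucket, s.left - 1, v :: s.seeds, s.gain⟩
      have h4 := ih (coverSets (sets v)
        ⟨s.deg, s.covered, s.bucket, s.left - 1, v :: s.seeds, s.gain⟩).val
        fun u hu => (deg_coverSets_le _ _ u).trans (hs u (List.mem_cons_of_mem _ hu))
      rw [bucket_coverSets] at h4
      simp only [h1, h2, if_true, if_false, Timed.cost_bind, Timed.val_bind, cost_tick,
        List.map_cons, List.sum_cons] at h3 h4 ⊢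
      omega
    · have h3 := hs v List.mem_cons_self
      have h4 := ih ⟨s.deg, s.covered,
        Function.update s.bucket (s.deg v) (v :: s.bucket (s.deg v)), s.left, s.seeds, s.gain⟩
        fun u hu => hs u (List.mem_cons_of_mem _ hu)
      have h5 := bucketPotential_update sets s.bucket d (s.deg v) v
      simp only [h1, h2, if_false, Timed.cost_bind, Timed.val_bind, cost_tick,
        List.map_cons, List.sum_cons] at h4 h5 ⊢
      omega

lemma cost_serveBuckets {sets : Fin n → List (ℕ × List (Fin n))} {len : ℕ → ℕ} {L : ℕ}
    (hsets : ∀ v, ∀ e ∈ sets v, e.1 < L ∧ e.2.length = len e.1) (d : ℕ)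
    (s : Greedy n) (hs : s.Sorted) :
    (serveBuckets sets d s).cost ≤
      d + bucketPotential sets s.bucket d + uncoveredSize len L s.covered := by
  induction d generalizing s with
  | zero => simp [serveBuckets]
  | succ d ih =>
    have h1 := cost_serveBucket hsets d (s.bucket (d + 1)) s (hs _)
    have h2 := ih _ (sorted_serveBucket sets (d + 1) (s.bucket (d + 1)) s hs)
    rw [bucketPotential_succ]
    simp only [serveBuckets, Timed.cost_bind, cost_tick]
    omega

lemma gain_le_serveBucket (sets : Fin n → List (ℕ × List (Fin n))) (d : ℕ) (vs : List (Fin n))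
    (s : Greedy n) : s.gain ≤ (serveBucket sets d vs s).val.gain := by
  induction vs generalizing s with
  | nil => exact le_rfl
  | cons v vs ih =>
    rw [serveBucket]
    split_ifs with h1 h2
    · exact le_rfl
    · exact (gain_le_coverSets (sets v)
        ⟨s.deg, s.covered, s.bucket, s.left - 1, v :: s.seeds, s.gain⟩).trans (ih _)
    · exact ih ⟨s.deg, s.covered,
        Function.update s.bucket (s.deg v) (v :: s.bucket (s.deg v)), s.left, s.seeds, s.gain⟩

lemma gain_le_serveBuckets (sets : Fin n → List (ℕ × List (Fin n))) (d : ℕ) (s : Greedy n) :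
    s.gain ≤ (serveBuckets sets d s).val.gain := by
  induction d generalizing s with
  | zero => exact le_rfl
  | succ d ih => exact (gain_le_serveBucket sets _ _ s).trans (ih _)

/-- The first node chosen has the greatest degree, and all its RR sets become covered. -/
lemma deg_le_gain_serveBuckets {sets : Fin n → List (ℕ × List (Fin n))} (d : ℕ) (s : Greedy n)
    (hleft : s.left ≠ 0) (hcov : ∀ i, s.covered i = false)
    (hmem : ∀ u j, 0 < j → (u ∈ s.bucket j ↔ s.deg u = j))
    (hlen : ∀ u, (sets u).length = s.deg u) (hnd : ∀ u, ((sets u).map Prod.fst).Nodup)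
    (v : Fin n) (hv : s.deg v ≤ d) :
    s.deg v ≤ (serveBuckets sets d s).val.gain := by
  induction d generalizing s with
  | zero => omega
  | succ d ih =>
    rw [serveBuckets]
    simp only [Timed.val_bind]
    cases hb : s.bucket (d + 1) with
    | nil =>
      refine ih s hleft hcov hmem hlen ?_
      have : s.deg v ≠ d + 1 := fun h => by
        have := (hmem v (d + 1) (Nat.succ_pos d)).2 h
        simp [hb] at this
      omega
    | cons u us =>
      have hu : s.deg u = d + 1 := (hmem u (d + 1) (Nat.succ_pos d)).1 (by simp [hb])
      refine le_trans ?_ (gain_le_serveBuckets sets d _)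
      rw [serveBucket]
      simp only [hleft, hu, if_false, if_true, Timed.val_bind]
      refine le_trans ?_ (gain_le_serveBucket sets (d + 1) us _)
      rw [gain_coverSets (sets u) ⟨s.deg, s.covered, s.bucket, s.left - 1, u :: s.seeds, s.gain⟩
        (hnd u) fun e _ => hcov e.1, hlen, hu]
      exact hv.trans (Nat.le_add_left _ _)

/-- The degree of `v` counts the listed occurrences of `v`, and the entries of `v` have numbers at
most `i`, without repetition; the number `i` occurs only if `v` has been listed. -/
lemma indexSet_spec (i : ℕ) (R vs : List (Fin n)) (hvs : vs.Nodup) (x : Incidence n)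
    (hx : ∀ v, ((x.sets v).map Prod.fst).Nodup)
    (hlt : ∀ v, ∀ e ∈ x.sets v, e.1 < i ∨ (e.1 = i ∧ v ∉ vs)) :
    (∀ v, (indexSet i R vs x).val.deg v = x.deg v + if v ∈ vs then 1 else 0) ∧
      (∀ v, (((indexSet i R vs x).val.sets v).map Prod.fst).Nodup) ∧
      ∀ v, ∀ e ∈ (indexSet i R vs x).val.sets v, e.1 < i + 1 := by
  induction vs generalizing x with
  | nil =>
    refine ⟨by simp [indexSet], hx, fun v e he => ?_⟩
    rcases hlt v e he with h | h <;> omega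
  | cons u vs ih =>
    rw [List.nodup_cons] at hvs
    rw [indexSet]
    simp only [Timed.val_bind]
    have key := ih hvs.2 ⟨Function.update x.deg u (x.deg u + 1),
      Function.update x.sets u ((i, R) :: x.sets u),
      if x.deg u = 0 then u :: x.touched else x.touched⟩ ?_ ?_
    · refine ⟨fun v => ?_, key.2⟩
      rw [key.1 v]
      by_cases h : v = u
      · subst h
        simp [hvs.1]
      · simp [h]
    · intro v
      by_cases h : v = u
      · subst h
        simp only [Function.update_self, List.map_cons, List.nodup_cons]
        refine ⟨fun hi => ?_, hx v⟩
        obtain ⟨e, he, hei⟩ := List.mem_map.1 hi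
        rcases hlt v e he with h | h
        · omega
        · exact h.2 List.mem_cons_self
      · simpa [h] using hx v
    · intro v e he
      by_cases h : v = u
      · subst h
        simp only [Function.update_self, List.mem_cons] at he
        rcases he with rfl | he
        · exact Or.inr ⟨rfl, hvs.1⟩
        · rcases hlt v e he with h | h
          · exact Or.inl h
          · exact absurd List.mem_cons_self h.2
      · simp only [Function.update_of_ne h] at he
        rcases hlt v e he with h | h
        · exact Or.inl h
        · exact Or.inr ⟨h.1, fun h' => h.2 (List.mem_cons_of_mem _ h')⟩

lemma indexAll_spec (i : ℕ) (RR : List (List (Fin n))) (hRR : ∀ R ∈ RR, R.Nodup)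
    (x : Incidence n) (hx : ∀ v, ((x.sets v).map Prod.fst).Nodup)
    (hlt : ∀ v, ∀ e ∈ x.sets v, e.1 < i) :
    (∀ v, (indexAll i RR x).val.deg v = x.deg v + RR.countP fun R => v ∈ R) ∧
      ∀ v, (((indexAll i RR x).val.sets v).map Prod.fst).Nodup := by
  induction RR generalizing i x with
  | nil => exact ⟨by simp [indexAll], hx⟩
  | cons R RR ih =>
    obtain ⟨h1, h2, h3⟩ := indexSet_spec i R R (hRR R List.mem_cons_self) x hx
      fun v e he => Or.inl (hlt v e he)
    obtain ⟨h4, h5⟩ := ih (i + 1) (fun R hR => hRR R (List.mem_cons_of_mem _ hR)) _ h2 h3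
    rw [indexAll]
    refine ⟨fun v => ?_, h5⟩
    simp only [Timed.val_bind, h4, h1, List.countP_cons, decide_eq_true_eq]
    omega

lemma wellFormed_indexAll_zero (RR : List (List (Fin n))) :
    (indexAll 0 RR ⟨fun _ => 0, fun _ => [], []⟩).val.WellFormed
      (fun i => (RR.getD i []).length) RR.length (RR.map List.length).sum := by
  have h0 : (⟨fun _ => 0, fun _ => [], []⟩ : Incidence n).WellFormed
      (fun i => (RR.getD i []).length) RR.length 0 :=
    ⟨by simp, by simp, by simp, by simp, by simp⟩
  have := wellFormed_indexAll (i := 0) RR (by simp) (fun j h => by simp [h]) _ h0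
  simpa using this

lemma cost_greedyMC (k : ℕ) (RR : List (List (Fin n))) :
    (greedyMC k RR).cost ≤ 1 + 3 * RR.length + 6 * (RR.map List.length).sum := by
  have hx := wellFormed_indexAll_zero RR
  set x := (indexAll 0 RR ⟨fun _ => 0, fun _ => [], []⟩).val with hx_def
  have hsum : (x.touched.map x.deg).sum ≤ (RR.map List.length).sum := by
    rw [← List.sum_toFinset _ hx.nodup, ← hx.sum_deg]
    exact Finset.sum_le_sum_of_subset (Finset.subset_univ _)
  have htouched : x.touched.length ≤ (x.touched.map x.deg).sum := by
    have := List.length_le_sum_of_one_le (x.touched.map x.deg) (by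
      intro i hi
      obtain ⟨v, hv, rfl⟩ := List.mem_map.1 hi
      exact Nat.one_le_iff_ne_zero.2 ((hx.mem_touched v).1 hv))
    simpa using this
  have hb := bucketPotential_fillBuckets x.sets x.deg x.touched (fun _ => []) RR.length
  have hb0 : bucketPotential x.sets (fun _ => []) RR.length = 0 := by simp [bucketPotential]
  have hb1 : (x.touched.map fun v => (x.sets v).length + x.deg v).sum =
      2 * (x.touched.map x.deg).sum := by
    simp only [hx.length_sets, ← two_mul, List.sum_map_mul_left]
  have hs := cost_serveBuckets (sets := x.sets) (len := fun i => (RR.getD i []).length)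
    hx.sets_spec RR.length
    ⟨x.deg, fun _ => false, (fillBuckets x.deg x.touched (fun _ => [])).val, k, [], 0⟩ (by
      intro d v hv
      simp only [mem_fillBuckets] at hv
      simp_all)
  have hu : uncoveredSize (fun i => (RR.getD i []).length) RR.length (fun _ => false) =
      (RR.map List.length).sum := by
    unfold uncoveredSize
    rw [← Fin.sum_univ_getElem, ← Fin.sum_univ_eq_sum_range
      (fun i => if false = true then 0 else (RR.getD i []).length)]
    refine Fintype.sum_equiv (finCongr (by simp)) _ _ fun i => ?_
    simp
  simp only [greedyMC, Timed.cost_bind, cost_tick, Timed.cost_pure,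
    cost_indexAll, cost_fillBuckets, ← hx_def]
  simp only at hs
  omega

/-- The greedy selection covers at least as many RR sets as any single node. -/
lemma countP_le_greedyMC {k : ℕ} (hk : 1 ≤ k) (RR : List (List (Fin n)))
    (hRR : ∀ R ∈ RR, R.Nodup) (v : Fin n) :
    RR.countP (fun R => v ∈ R) ≤ (greedyMC k RR).val.2 := by
  have hx := wellFormed_indexAll_zero RR
  obtain ⟨h1, h2⟩ := indexAll_spec 0 RR hRR ⟨fun _ => 0, fun _ => [], []⟩ (by simp) (by simp)
  set x := (indexAll 0 RR ⟨fun _ => 0, fun _ => [], []⟩).val with hx_def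
  have h3 := deg_le_gain_serveBuckets (sets := x.sets) RR.length
    ⟨x.deg, fun _ => false, (fillBuckets x.deg x.touched (fun _ => [])).val, k, [], 0⟩
    (by simp; omega) (fun _ => rfl) (by
      intro u j hj
      simp only [mem_fillBuckets, hx.mem_touched]
      simp
      omega) hx.length_sets h2 v (by simpa [h1] using List.countP_le_length)
  simp only [h1, zero_add] at h3
  exact h3

end Greedy

/-! ### The rounds of the main loop -/

section Rounds

variable {n : ℕ}

/-- The collection of the first `N` RR sets of a tape, the last one first. -/
def rrPrefix (G : SocialNetwork n) (tape : ℕ → Draw n) : ℕ → List (List (Fin n))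
  | 0 => []
  | N + 1 => (generateRR G (tape N)).val :: rrPrefix G tape N

lemma length_rrPrefix (G : SocialNetwork n) (tape : ℕ → Draw n) (N : ℕ) :
    (rrPrefix G tape N).length = N := by
  induction N with
  | zero => rfl
  | succ N ih => simp [rrPrefix, ih]

lemma nodup_of_mem_rrPrefix (G : SocialNetwork n) (tape : ℕ → Draw n) (N : ℕ) :
    ∀ R ∈ rrPrefix G tape N, R.Nodup := by
  induction N with
  | zero => simp [rrPrefix]
  | succ N ih =>
    simp only [rrPrefix, List.mem_cons, forall_eq_or_imp]
    exact ⟨nodup_generateRR G _, ih⟩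

/-- The number of the first `N` RR sets of a tape that contain `v`. -/
def coverCount (G : SocialNetwork n) (v : Fin n) (tape : ℕ → Draw n) (N : ℕ) : ℕ :=
  ∑ i ∈ Finset.range N, if v ∈ (generateRR G (tape i)).val then 1 else 0

lemma countP_rrPrefix (G : SocialNetwork n) (v : Fin n) (tape : ℕ → Draw n) (N : ℕ) :
    (rrPrefix G tape N).countP (fun R => v ∈ R) = coverCount G v tape N := by
  induction N with
  | zero => rfl
  | succ N ih =>
    rw [coverCount] at ih ⊢
    rw [Finset.sum_range_succ, ← ih]
    simp [rrPrefix, List.countP_cons]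

lemma sum_length_rrPrefix_le (G : SocialNetwork n) (tape : ℕ → Draw n) (N : ℕ) :
    ((rrPrefix G tape N).map List.length).sum ≤ ∑ i ∈ Finset.range N, workload G (tape i) := by
  induction N with
  | zero => simp [rrPrefix]
  | succ N ih =>
    have := length_generateRR_le_workload G (tape N)
    simp only [rrPrefix, List.map_cons, List.sum_cons, Finset.sum_range_succ]
    omega

lemma le_sum_workload (G : SocialNetwork n) (tape : ℕ → Draw n) (N : ℕ) :
    N ≤ ∑ i ∈ Finset.range N, workload G (tape i) := by
  simpa using Finset.card_nsmul_le_sum (Finset.range N) _ 1 fun i _ => one_le_workload G (tape i)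

lemma val_generateMany (G : SocialNetwork n) (tape : ℕ → Draw n) (c N : ℕ) :
    (generateMany G tape c (rrPrefix G tape N)).val = rrPrefix G tape (N + c) := by
  induction c generalizing N with
  | zero => rfl
  | succ c ih =>
    rw [generateMany]
    simp only [Timed.val_bind, length_rrPrefix]
    rw [show N + (c + 1) = N + 1 + c by omega, ← ih (N + 1)]
    rfl

lemma cost_generateMany (G : SocialNetwork n) (tape : ℕ → Draw n) (c N : ℕ) :
    (generateMany G tape c (rrPrefix G tape N)).cost +
        4 * ∑ i ∈ Finset.range N, workload G (tape i) ≤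
      4 * ∑ i ∈ Finset.range (N + c), workload G (tape i) := by
  induction c generalizing N with
  | zero => simp [generateMany]
  | succ c ih =>
    have h1 := ih (N + 1)
    have h2 := cost_generateRR G (tape N)
    have h3 := one_le_workload G (tape N)
    rw [Finset.sum_range_succ, rrPrefix] at h1
    rw [generateMany, show N + (c + 1) = N + 1 + c by omega]
    simp only [Timed.cost_bind, length_rrPrefix, cost_tick]
    omega

/-- The check point `N_R⁰` at the beginning of a round. -/
noncomputable def roundLo (γ : ℝ) : ℕ → ℝ
  | 0 => 1
  | r + 1 => 2 ^ r * γ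

/-- The number of RR sets at the beginning of a round. -/
noncomputable def roundSize (γ : ℝ) : ℕ → ℕ
  | 0 => 0
  | r + 1 => roundSize γ r + (⌊2 ^ r * γ - roundLo γ r⌋₊ + 1)

lemma monotone_roundSize (γ : ℝ) : Monotone (roundSize γ) :=
  monotone_nat_of_le_succ fun r => by simp [roundSize]

lemma roundSize_succ_le_add {γ : ℝ} (hγ : 1 ≤ γ) (r : ℕ) :
    (roundSize γ (r + 1) : ℝ) ≤ 2 ^ r * γ + r := by
  induction r with
  | zero =>
    have := Nat.floor_le (show 0 ≤ γ - 1 by linarith)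
    simp only [roundSize, roundLo, pow_zero, one_mul]
    push_cast
    linarith
  | succ r ih =>
    have h2 : 0 ≤ 2 ^ r * γ := by positivity
    have h3 := Nat.floor_le (show 0 ≤ 2 ^ (r + 1) * γ - 2 ^ r * γ by rw [pow_succ]; linarith)
    rw [roundSize, roundLo]
    push_cast
    linarith

lemma roundSize_succ_le {γ : ℝ} (hγ : 1 ≤ γ) (r : ℕ) :
    (roundSize γ (r + 1) : ℝ) ≤ 2 * (2 ^ r * γ) := by
  have h1 := roundSize_succ_le_add hγ r
  have h2 : (r : ℝ) ≤ 2 ^ r := by exact_mod_cast Nat.lt_two_pow_self.le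
  have h3 : (2 : ℝ) ^ r * 1 ≤ 2 ^ r * γ := by gcongr
  linarith

lemma le_roundSize_succ (γ : ℝ) (r : ℕ) :
    2 ^ r * γ / 2 ≤ (roundSize γ (r + 1) : ℝ) := by
  have h := Nat.lt_floor_add_one (2 ^ r * γ - roundLo γ r)
  have h0 : (0 : ℝ) ≤ roundSize γ r := Nat.cast_nonneg _
  rw [roundSize]
  push_cast
  cases r with
  | zero =>
    have h1 : (0 : ℝ) ≤ ⌊(2 : ℝ) ^ 0 * γ - roundLo γ 0⌋₊ := Nat.cast_nonneg _
    simp only [roundLo, pow_zero, one_mul] at *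
    linarith
  | succ r =>
    simp only [roundLo, pow_succ] at *
    linarith

variable (G : SocialNetwork n) (k : ℕ) (γ : ℝ)

/-- The state of the main loop at the beginning of the round `r`. -/
structure Main.AtRound (tape : ℕ → Draw n) (r : ℕ) (s : Main n) : Prop where
  RR_eq : s.RR = rrPrefix G tape (roundSize γ r)
  lo_eq : s.lo = roundLo γ r
  hi_eq : s.hi = 2 ^ r * γ
  le_deg : ∀ v, coverCount G v tape (roundSize γ r) ≤ s.deg

variable {G k γ}

lemma atRound_zero (tape : ℕ → Draw n) : Main.AtRound G γ tape 0 ⟨[], 1, γ, [], 0⟩ :=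
  ⟨rfl, rfl, by simp, fun _ => le_rfl⟩

lemma Main.AtRound.generate {tape : ℕ → Draw n} {r : ℕ} {s : Main n}
    (hs : s.AtRound G γ tape r) :
    (generateMany G tape (⌊s.hi - s.lo⌋₊ + 1) s.RR).val =
      rrPrefix G tape (roundSize γ (r + 1)) := by
  rw [hs.RR_eq, hs.hi_eq, hs.lo_eq, val_generateMany, roundSize]

lemma Main.AtRound.step (hk : 1 ≤ k) {tape : ℕ → Draw n} {r : ℕ} {s : Main n}
    (hs : s.AtRound G γ tape r) : (mainBody G k tape s).val.AtRound G γ tape (r + 1) := by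
  refine ⟨hs.generate, ?_, ?_, fun v => ?_⟩
  · simp [mainBody, hs.hi_eq, roundLo]
  · simp [mainBody, hs.hi_eq, pow_succ]
    ring
  · simp only [mainBody, Timed.val_bind, Timed.val_pure, hs.generate, ← countP_rrPrefix]
    exact countP_le_greedyMC hk _ (nodup_of_mem_rrPrefix G tape _) v

lemma Main.AtRound.cost_mainBody {tape : ℕ → Draw n} {r : ℕ} {s : Main n}
    (hs : s.AtRound G γ tape r) :
    (mainBody G k tape s).cost + 1 ≤
      16 * ∑ i ∈ Finset.range (roundSize γ (r + 1)), workload G (tape i) := by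
  have h1 := cost_generateMany G tape (⌊s.hi - s.lo⌋₊ + 1) (roundSize γ r)
  have h2 := cost_greedyMC k (rrPrefix G tape (roundSize γ (r + 1)))
  have h3 := sum_length_rrPrefix_le G tape (roundSize γ (r + 1))
  have h4 := le_sum_workload G tape (roundSize γ (r + 1))
  have h5 : 1 ≤ roundSize γ (r + 1) := by
    rw [roundSize]
    omega
  have h6 : roundSize γ r + (⌊s.hi - s.lo⌋₊ + 1) = roundSize γ (r + 1) := by
    rw [hs.hi_eq, hs.lo_eq, roundSize]
  rw [h6, ← hs.RR_eq] at h1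
  rw [length_rrPrefix] at h2
  simp only [mainBody, Timed.cost_bind, cost_tick, Timed.cost_pure, hs.generate]
  omega

lemma cost_mainLoop (hk : 1 ≤ k) (v : Fin n) (tape : ℕ → Draw n) (f r : ℕ) (s : Main n)
    (hs : s.AtRound G γ tape r) :
    (mainLoop G k γ tape f s).cost ≤ 1 + ∑ j ∈ Finset.range f,
      if (coverCount G v tape (roundSize γ (r + j)) : ℝ) < γ then
        16 * ∑ i ∈ Finset.range (roundSize γ (r + j + 1)), workload G (tape i) else 0 := by
  induction f generalizing r s with
  | zero => simp [mainLoop]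
  | succ f ih =>
    rw [mainLoop, Finset.sum_range_succ']
    by_cases h : (s.deg : ℝ) < γ
    · have h1 : (coverCount G v tape (roundSize γ r) : ℝ) < γ :=
        lt_of_le_of_lt (by exact_mod_cast hs.le_deg v) h
      have h2 := ih (r + 1) _ (hs.step hk)
      have h3 := hs.cost_mainBody (k := k)
      simp only [h, h1, add_zero, if_true, Timed.cost_bind, cost_tick] at h2 ⊢
      simp only [add_assoc, add_comm 1] at h2 h3 ⊢
      omega
    · simp [h]

lemma cost_targetedIM (hk : 1 ≤ k) (v : Fin n) (tape : ℕ → Draw n) (f : ℕ) :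
    (targetedIM G k γ tape f).cost ≤ n + 1 + ∑ r ∈ Finset.range f,
      if (coverCount G v tape (roundSize γ r) : ℝ) < γ then
        16 * ∑ i ∈ Finset.range (roundSize γ (r + 1)), workload G (tape i) else 0 := by
  have := cost_mainLoop hk v tape f 0 _ (atRound_zero (G := G) (γ := γ) tape)
  simp only [zero_add] at this
  simp only [targetedIM, Timed.cost_bind, cost_tick]
  omega

lemma generateMany_congr {tape tape' : ℕ → Draw n} (c : ℕ) (RR : List (List (Fin n)))
    (h : ∀ i < RR.length + c, tape i = tape' i) :
    generateMany G tape c RR = generateMany G tape' c RR := by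
  induction c generalizing RR with
  | zero => rfl
  | succ c ih =>
    rw [generateMany, generateMany, h RR.length (by omega)]
    congr 1
    funext _
    congr 1
    funext R
    exact ih _ fun i hi => h i (by simp at hi; omega)

lemma length_val_generateMany (tape : ℕ → Draw n) (c : ℕ) (RR : List (List (Fin n))) :
    (generateMany G tape c RR).val.length = RR.length + c := by
  induction c generalizing RR with
  | zero => rfl
  | succ c ih =>
    simp only [generateMany, Timed.val_bind, ih, List.length_cons]
    omega

/-- A run that is cut off depends on a finite part of the tape only. -/
lemma mainLoop_congr {tape tape' : ℕ → Draw n} (f r : ℕ) (s : Main n)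
    (h : ∀ i < roundSize γ (r + f), tape i = tape' i) (hRR : s.RR.length = roundSize γ r)
    (hlo : s.lo = roundLo γ r) (hhi : s.hi = 2 ^ r * γ) :
    mainLoop G k γ tape f s = mainLoop G k γ tape' f s := by
  induction f generalizing r s with
  | zero => rfl
  | succ f ih =>
    have h1 : s.RR.length + (⌊s.hi - s.lo⌋₊ + 1) = roundSize γ (r + 1) := by
      rw [hhi, hlo, hRR, roundSize]
    have h2 : mainBody G k tape s = mainBody G k tape' s := by
      rw [mainBody, mainBody, generateMany_congr]
      intro i hi
      exact h i (hi.trans_le (h1.trans_le (monotone_roundSize γ (by omega))))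
    rw [mainLoop, mainLoop, h2]
    congr 1
    funext _
    split_ifs with hd
    · have h3 := ih (r + 1) (mainBody G k tape' s).val
        (fun i hi => h i (by rwa [show r + (f + 1) = r + 1 + f by omega]))
        (by
          simp only [mainBody, Timed.val_bind, Timed.val_pure]
          rw [length_val_generateMany, h1])
        (by simp [mainBody, hhi, roundLo])
        (by simp only [mainBody, Timed.val_bind, Timed.val_pure, hhi, pow_succ]; ring)
      change Timed.mk (mainLoop G k γ tape f _).val (_ + (mainLoop G k γ tape f _).cost) = _
      rw [h3]
      rfl
    · rfl

lemma targetedIM_congr {tape tape' : ℕ → Draw n} (f : ℕ)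
    (h : ∀ i < roundSize γ f, tape i = tape' i) :
    targetedIM G k γ tape f = targetedIM G k γ tape' f := by
  rw [targetedIM, targetedIM, mainLoop_congr f 0 _ (by simpa using h) rfl rfl (by simp)]

lemma measurable_runningTime : Measurable (runningTime G k γ) := by
  refine Measurable.iSup fun f => ?_
  obtain ⟨v, -⟩ := G.exists_critical
  let extend : (Fin (roundSize γ f) → Draw n) → ℕ → Draw n :=
    fun x i => if h : i < roundSize γ f then x ⟨i, h⟩ else (v, fun _ _ => false)
  have : (fun tape => ((targetedIM G k γ tape f).cost : ℝ≥0∞)) =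
      (fun x => ((targetedIM G k γ (extend x) f).cost : ℝ≥0∞)) ∘
        fun (tape : ℕ → Draw n) (i : Fin (roundSize γ f)) => tape i := by
    funext tape
    simp only [Function.comp]
    rw [targetedIM_congr (tape' := extend fun i => tape i)]
    intro i hi
    simp [extend, hi]
  rw [this]
  exact (measurable_of_countable _).comp (measurable_pi_lambda _ fun i => measurable_pi_apply _)

end Rounds

/-! ### Expectations -/

section Expectation

variable {n : ℕ} (G : SocialNetwork n)

/-- The probability that a random RR set contains `v`. -/
noncomputable def hitProb (v : Fin n) : ℝ := G.drawLaw.real {d | v ∈ (generateRR G d).val}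

lemma hitProb_nonneg (v : Fin n) : 0 ≤ hitProb G v := measureReal_nonneg

lemma hitProb_le_one (v : Fin n) : hitProb G v ≤ 1 := measureReal_le_one

lemma lintegral_workload_le {p : ℝ} (hp : ∀ v, hitProb G v ≤ p) :
    ∫⁻ d, (workload G d : ℝ≥0∞) ∂G.drawLaw ≤ ENNReal.ofReal (p * (n + G.links.card)) := by
  have h1 : ∀ v, ∫⁻ d, (if v ∈ (generateRR G d).val then ((1 + (G.inList v).length : ℕ) : ℝ≥0∞)
      else 0) ∂G.drawLaw ≤ ENNReal.ofReal (p * (1 + (G.inList v).length : ℕ)) := by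
    intro v
    have h2 : (fun d => if v ∈ (generateRR G d).val then ((1 + (G.inList v).length : ℕ) : ℝ≥0∞)
        else 0) = Set.indicator {d | v ∈ (generateRR G d).val}
          fun _ => ((1 + (G.inList v).length : ℕ) : ℝ≥0∞) := by
      funext d
      simp [Set.indicator_apply]
    rw [h2, lintegral_indicator_const (Set.to_countable _).measurableSet, mul_comm p,
      ENNReal.ofReal_mul (Nat.cast_nonneg _), ENNReal.ofReal_natCast]
    gcongr
    rw [← ofReal_measureReal]
    exact ENNReal.ofReal_le_ofReal (hp v)
  have hp0 : ∀ v : Fin n, 0 ≤ p := fun v => (hitProb_nonneg G v).trans (hp v)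
  have h3 : ∀ d, (workload G d : ℝ≥0∞) = ∑ v, if v ∈ (generateRR G d).val then
      ((1 + (G.inList v).length : ℕ) : ℝ≥0∞) else 0 := by
    intro d
    rw [workload_eq_sum]
    push_cast
    rfl
  simp_rw [h3]
  rw [lintegral_finsetSum _ fun v _ => measurable_of_countable _]
  refine (Finset.sum_le_sum fun v _ => h1 v).trans ?_
  rw [← ENNReal.ofReal_sum_of_nonneg fun v _ => mul_nonneg (hp0 v) (Nat.cast_nonneg _),
    ← Finset.mul_sum, ← Nat.cast_sum, Finset.sum_add_distrib, sum_length_inList]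
  simp

/-- The factor that discounts a draw whose RR set contains `v`. -/
noncomputable def discount (v : Fin n) (d : Draw n) : ℝ≥0∞ :=
  if v ∈ (generateRR G d).val then 2⁻¹ else 1

lemma lintegral_discount_le (v : Fin n) :
    ∫⁻ d, discount G v d ∂G.drawLaw ≤ ENNReal.ofReal (Real.exp (-(hitProb G v / 2))) := by
  have hm : MeasurableSet {d | v ∈ (generateRR G d).val} := (Set.to_countable _).measurableSet
  have h1 : ∀ d, discount G v d = ENNReal.ofReal
      (1 - Set.indicator {d | v ∈ (generateRR G d).val} (fun _ => (2⁻¹ : ℝ)) d) := by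
    intro d
    by_cases h : v ∈ (generateRR G d).val
    · simp only [discount, h, if_true, Set.indicator_apply, Set.mem_ofPred_eq]
      rw [show (1 : ℝ) - 2⁻¹ = 2⁻¹ by norm_num, ENNReal.ofReal_inv_of_pos two_pos]
      simp
    · simp [discount, h]
  have hi : Integrable (Set.indicator {d | v ∈ (generateRR G d).val} fun _ => (2⁻¹ : ℝ))
      G.drawLaw := (integrable_const _).indicator hm
  simp_rw [h1]
  have hi' : Integrable (fun d => 1 - Set.indicator {d | v ∈ (generateRR G d).val}
      (fun _ => (2⁻¹ : ℝ)) d) G.drawLaw := (integrable_const 1).sub hi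
  rw [← ofReal_integral_eq_lintegral_ofReal hi']
  · refine ENNReal.ofReal_le_ofReal ?_
    rw [integral_sub (integrable_const _) hi, integral_indicator_const _ hm]
    have := Real.add_one_le_exp (-(hitProb G v / 2))
    simp only [integral_const, probReal_univ, smul_eq_mul, mul_one]
    rw [← hitProb]
    linarith
  · refine Filter.Eventually.of_forall fun d => ?_
    by_cases h : v ∈ (generateRR G d).val
    · simp only [Set.indicator_apply, Set.mem_ofPred_eq, h, if_true, Pi.zero_apply]
      norm_num
    · simp [h]

/-- The workload of the draw number `i`, if among the first `N` RR sets fewer than `γ` contain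
`v`. -/
noncomputable def stoppedWorkload (γ : ℝ) (v : Fin n) (N i : ℕ) (tape : ℕ → Draw n) : ℝ≥0∞ :=
  if (coverCount G v tape N : ℝ) < γ then (workload G (tape i) : ℝ≥0∞) else 0

lemma measurable_stoppedWorkload (γ : ℝ) (v : Fin n) (N i : ℕ) :
    Measurable (stoppedWorkload G γ v N i) := by
  have h1 : Measurable fun tape : ℕ → Draw n => (coverCount G v tape N : ℝ) := by
    unfold coverCount
    push_cast
    refine Finset.measurable_sum _ fun j _ => ?_
    exact (measurable_of_countable
      fun d : Draw n => if v ∈ (generateRR G d).val then (1 : ℝ) else 0).comp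
        (measurable_pi_apply j)
  refine Measurable.ite (measurableSet_lt h1 measurable_const) ?_ measurable_const
  exact (measurable_of_countable fun d : Draw n => (workload G d : ℝ≥0∞)).comp
    (measurable_pi_apply i)

lemma stoppedWorkload_le (γ : ℝ) (v : Fin n) (N i : ℕ) (tape : ℕ → Draw n) :
    stoppedWorkload G γ v N i tape ≤ ENNReal.ofReal (Real.exp γ) *
      (workload G (tape i) * ∏ j ∈ (Finset.range N).erase i, discount G v (tape j)) := by
  unfold stoppedWorkload
  split_ifs with h
  swap
  · exact zero_le
  unfold discount
  rw [Finset.prod_ite, Finset.prod_const, Finset.prod_const_one, mul_one, ← mul_assoc,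
    mul_comm (ENNReal.ofReal _), mul_assoc]
  refine le_mul_of_one_le_right zero_le ?_
  set c := (((Finset.range N).erase i).filter fun j => v ∈ (generateRR G (tape j)).val).card
  have hc : c ≤ coverCount G v tape N := by
    rw [coverCount, ← Finset.card_filter]
    exact Finset.card_le_card (Finset.filter_subset_filter _ (Finset.erase_subset _ _))
  have h1 : (2 : ℝ) ^ c ≤ Real.exp γ := calc
    (2 : ℝ) ^ c ≤ Real.exp 1 ^ c := by
        gcongr
        linarith [Real.add_one_le_exp 1]
    _ = Real.exp c := by rw [← Real.exp_nat_mul, mul_one]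
    _ ≤ Real.exp γ := Real.exp_le_exp.2 ((Nat.cast_le.2 hc).trans h.le)
  calc (1 : ℝ≥0∞) = 2 ^ c * 2⁻¹ ^ c := by
        rw [← mul_pow, ENNReal.mul_inv_cancel two_ne_zero ENNReal.ofNat_ne_top, one_pow]
    _ ≤ _ := by
        gcongr
        rw [← ENNReal.ofReal_ofNat 2, ← ENNReal.ofReal_pow zero_le_two]
        exact ENNReal.ofReal_le_ofReal h1

lemma lintegral_eval (f : Draw n → ℝ≥0∞) (i : ℕ) :
    ∫⁻ tape, f (tape i) ∂G.tapeLaw = ∫⁻ d, f d ∂G.drawLaw :=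
  (measurePreserving_eval_infinitePi (fun _ : ℕ => G.drawLaw) i).lintegral_comp
    (measurable_of_countable f)

lemma lintegral_workload_mul_prod_discount (v : Fin n) (i : ℕ) {s : Finset ℕ} (hi : i ∉ s) :
    ∫⁻ tape, workload G (tape i) * ∏ j ∈ s, discount G v (tape j) ∂G.tapeLaw =
      (∫⁻ d, workload G d ∂G.drawLaw) * (∫⁻ d, discount G v d ∂G.drawLaw) ^ s.card := by
  classical
  let X : ℕ → Draw n → ℝ≥0∞ := fun j d => if j = i then (workload G d : ℝ≥0∞) else discount G v d
  have hX : ∀ j ∈ s, ∀ d, X j d = discount G v d := by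
    intro j hj d
    simp [X, ne_of_mem_of_not_mem hj hi]
  have h := lintegral_prod_eq_prod_lintegral_of_indepFun (insert i s)
    (fun j (tape : ℕ → Draw n) => X j (tape j))
    (iIndepFun_infinitePi (P := fun _ : ℕ => G.drawLaw) fun j => measurable_of_countable (X j))
    (fun j => (measurable_of_countable (X j)).comp (measurable_pi_apply j))
  simp_rw [Finset.prod_insert hi] at h
  have h1 : ∀ tape : ℕ → Draw n, ∏ j ∈ s, X j (tape j) = ∏ j ∈ s, discount G v (tape j) :=
    fun tape => Finset.prod_congr rfl fun j hj => hX j hj _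
  have h2 : ∀ j ∈ s, ∫⁻ tape, X j (tape j) ∂Measure.infinitePi (fun _ : ℕ => G.drawLaw) =
      ∫⁻ d, discount G v d ∂G.drawLaw := by
    intro j hj
    simp_rw [hX j hj]
    exact lintegral_eval G _ j
  rw [Finset.prod_congr rfl h2, Finset.prod_const] at h
  simp_rw [h1] at h
  have h3 : ∫⁻ tape, X i (tape i) ∂Measure.infinitePi (fun _ : ℕ => G.drawLaw) =
      ∫⁻ d, workload G d ∂G.drawLaw := by
    simp only [X, if_true]
    exact lintegral_eval G (fun d => (workload G d : ℝ≥0∞)) i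
  rw [h3] at h
  simpa [X, SocialNetwork.tapeLaw] using h

lemma lintegral_stoppedWorkload_le (γ : ℝ) (v : Fin n) (N i : ℕ) :
    ∫⁻ tape, stoppedWorkload G γ v N i tape ∂G.tapeLaw ≤
      ENNReal.ofReal (min 1 (Real.exp (γ + 1 / 2 - hitProb G v * N / 2))) *
        ∫⁻ d, workload G d ∂G.drawLaw := by
  have h1 : ∫⁻ tape, stoppedWorkload G γ v N i tape ∂G.tapeLaw ≤
      1 * ∫⁻ d, workload G d ∂G.drawLaw := by
    rw [one_mul, ← lintegral_eval G (fun d => (workload G d : ℝ≥0∞)) i]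
    refine lintegral_mono fun tape => ?_
    rw [stoppedWorkload]
    split_ifs
    · exact le_rfl
    · exact zero_le
  have h2 : ∫⁻ tape, stoppedWorkload G γ v N i tape ∂G.tapeLaw ≤
      ENNReal.ofReal (Real.exp (γ + 1 / 2 - hitProb G v * N / 2)) *
        ∫⁻ d, workload G d ∂G.drawLaw := by
    refine (lintegral_mono (stoppedWorkload_le G γ v N i)).trans ?_
    rw [lintegral_const_mul' _ _ ENNReal.ofReal_ne_top,
      lintegral_workload_mul_prod_discount G v i (Finset.notMem_erase i _), mul_comm (lintegral _ _),
      ← mul_assoc]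
    gcongr
    refine (mul_le_mul_right (pow_le_pow_left' (lintegral_discount_le G v) _) _).trans ?_
    rw [← ENNReal.ofReal_pow (Real.exp_nonneg _), ← ENNReal.ofReal_mul (Real.exp_nonneg _),
      ← Real.exp_nat_mul, ← Real.exp_add]
    refine ENNReal.ofReal_le_ofReal (Real.exp_le_exp.2 ?_)
    have h3 : (N : ℝ) ≤ ((Finset.range N).erase i).card + 1 := by
      have := Finset.pred_card_le_card_erase (s := Finset.range N) (a := i)
      rw [Finset.card_range] at this
      exact_mod_cast (by omega : N ≤ ((Finset.range N).erase i).card + 1)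
    have h4 := mul_le_mul_of_nonneg_left h3 (hitProb_nonneg G v)
    have h5 := hitProb_le_one G v
    linarith
  rcases min_choice 1 (Real.exp (γ + 1 / 2 - hitProb G v * N / 2)) with h | h
  · rw [h, ENNReal.ofReal_one]
    exact h1
  · rw [h]
    exact h2

end Expectation

/-! ### Summation over the rounds -/

lemma min_one_exp_mul_le {γ x : ℝ} (hγ : 1 ≤ γ) (hx : 0 ≤ x) :
    min 1 (Real.exp (γ + 1 / 2 - x * γ / 4)) * ((1 + x) * (1 + 2 * x)) ≤ 768 := by
  by_cases h : x ≤ 8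
  · calc _ ≤ 1 * ((1 + x) * (1 + 2 * x)) := by
          gcongr
          exact min_le_left _ _
      _ ≤ 768 := by nlinarith
  · push Not at h
    have h1 : γ + 1 / 2 - x * γ / 4 ≤ 1 / 2 + -(x / 8) := by nlinarith
    have h2 : Real.exp (1 / 2) ≤ 2 := by
      have h3 : Real.exp (1 / 2) * Real.exp (1 / 2) < 3 := by
        rw [← Real.exp_add]
        norm_num
        exact Real.exp_one_lt_three
      nlinarith [Real.exp_pos (1 / 2)]
    have h3 : x ^ 2 / 128 ≤ Real.exp (x / 8) := by
      have := Real.quadratic_le_exp_of_nonneg (show 0 ≤ x / 8 by linarith)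
      nlinarith
    calc _ ≤ Real.exp (1 / 2 + -(x / 8)) * ((1 + x) * (1 + 2 * x)) := by
          gcongr
          exact (min_le_right _ _).trans (Real.exp_le_exp.2 h1)
      _ ≤ 2 * (Real.exp (x / 8))⁻¹ * (3 * x ^ 2) := by
          rw [Real.exp_add, Real.exp_neg]
          refine mul_le_mul (by gcongr) ?_ (by positivity) (by positivity)
          nlinarith
      _ ≤ 2 * (Real.exp (x / 8))⁻¹ * (384 * Real.exp (x / 8)) := by
          refine mul_le_mul_of_nonneg_left ?_ (by positivity)
          linarith
      _ = 768 := by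
          field_simp
          norm_num

/-- With `x / (1 + x)` increasing from `0` to `1`, the sum along `x, 2 x, 4 x, …` telescopes. -/
lemma mul_min_one_exp_le {γ x : ℝ} (hγ : 1 ≤ γ) (hx : 0 ≤ x) :
    x * min 1 (Real.exp (γ + 1 / 2 - x * γ / 4)) ≤
      768 * (2 * x / (1 + 2 * x) - x / (1 + x)) := by
  have h := min_one_exp_mul_le hγ hx
  have h1 : 2 * x / (1 + 2 * x) - x / (1 + x) = x / ((1 + x) * (1 + 2 * x)) := by
    field_simp
    ring
  rw [h1, mul_div_assoc', le_div_iff₀ (by positivity)]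
  nlinarith

section RunningTime

variable {n : ℕ} (G : SocialNetwork n) (k : ℕ) (γ : ℝ)

/-- A bound for the number of operations of a round of the main loop, if the loop gets there. -/
noncomputable def roundBound (v : Fin n) (r : ℕ) (tape : ℕ → Draw n) : ℝ≥0∞ :=
  ∑ i ∈ Finset.range (roundSize γ (r + 1)), 16 * stoppedWorkload G γ v (roundSize γ r) i tape

variable {k γ}

lemma runningTime_le (hk : 1 ≤ k) (v : Fin n) (tape : ℕ → Draw n) :
    runningTime G k γ tape ≤ (n + 1 : ℕ) + ∑' r, roundBound G γ v r tape := by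
  refine iSup_le fun f => ?_
  refine le_trans ?_ (add_le_add_right (ENNReal.sum_le_tsum (Finset.range f)) _)
  refine (Nat.cast_le.2 (cost_targetedIM hk v tape f)).trans (le_of_eq ?_)
  rw [Nat.cast_add, Nat.cast_sum]
  congr 1
  refine Finset.sum_congr rfl fun r _ => ?_
  rw [roundBound, ← Finset.mul_sum]
  unfold stoppedWorkload
  split_ifs <;> simp

lemma measurable_roundBound (v : Fin n) (r : ℕ) : Measurable (roundBound G γ v r) :=
  Finset.measurable_sum _ fun i _ => (measurable_stoppedWorkload G γ v _ i).const_mul _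

lemma lintegral_roundBound_le (v : Fin n) (hv : ∀ u, hitProb G u ≤ hitProb G v) (r : ℕ) :
    ∫⁻ tape, roundBound G γ v r tape ∂G.tapeLaw ≤ ENNReal.ofReal (roundSize γ (r + 1) *
      (16 * (min 1 (Real.exp (γ + 1 / 2 - hitProb G v * roundSize γ r / 2)) *
        (hitProb G v * (n + G.links.card))))) := by
  have h0 : 0 ≤ min 1 (Real.exp (γ + 1 / 2 - hitProb G v * roundSize γ r / 2)) :=
    le_min zero_le_one (Real.exp_nonneg _)
  unfold roundBound
  rw [lintegral_finsetSum _ fun i _ => (measurable_stoppedWorkload G γ v _ i).const_mul _,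
    ENNReal.ofReal_mul (Nat.cast_nonneg _), ENNReal.ofReal_natCast,
    ENNReal.ofReal_mul (by norm_num), ENNReal.ofReal_mul h0, ENNReal.ofReal_ofNat]
  refine (Finset.sum_le_card_nsmul _ _ _ fun i _ => ?_).trans
    (by rw [Finset.card_range, nsmul_eq_mul])
  rw [lintegral_const_mul' _ _ ENNReal.ofNat_ne_top]
  gcongr
  refine (lintegral_stoppedWorkload_le G γ v _ i).trans ?_
  gcongr
  exact lintegral_workload_le G hv

lemma lintegral_roundBound_zero_le (hγ : 1 ≤ γ) (v : Fin n)
    (hv : ∀ u, hitProb G u ≤ hitProb G v) :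
    ∫⁻ tape, roundBound G γ v 0 tape ∂G.tapeLaw ≤
      ENNReal.ofReal (32 * γ * (n + G.links.card)) := by
  refine (lintegral_roundBound_le G v hv 0).trans (ENNReal.ofReal_le_ofReal ?_)
  have h1 := roundSize_succ_le hγ 0
  have h2 := hitProb_nonneg G v
  calc _ ≤ 2 * (2 ^ 0 * γ) * (16 * (1 * (1 * ((n : ℝ) + G.links.card)))) := by
        gcongr
        · exact min_le_left _ _
        · exact hitProb_le_one G v
    _ = _ := by ring

lemma lintegral_roundBound_succ_le (hγ : 1 ≤ γ) (v : Fin n)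
    (hv : ∀ u, hitProb G u ≤ hitProb G v) (r : ℕ) :
    ∫⁻ tape, roundBound G γ v (r + 1) tape ∂G.tapeLaw ≤
      ENNReal.ofReal (64 * 768 * γ * (n + G.links.card) *
        (2 ^ (r + 1) * hitProb G v / (1 + 2 ^ (r + 1) * hitProb G v) -
          2 ^ r * hitProb G v / (1 + 2 ^ r * hitProb G v))) := by
  refine (lintegral_roundBound_le G v hv (r + 1)).trans (ENNReal.ofReal_le_ofReal ?_)
  set p := hitProb G v
  have hp : 0 ≤ p := hitProb_nonneg G v
  have h1 := roundSize_succ_le hγ (r + 1)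
  have h2 := mul_le_mul_of_nonneg_left (le_roundSize_succ γ r) hp
  have h3 := mul_min_one_exp_le hγ (show 0 ≤ 2 ^ r * p by positivity)
  have h4 : γ + 1 / 2 - p * roundSize γ (r + 1) / 2 ≤ γ + 1 / 2 - 2 ^ r * p * γ / 4 := by linarith
  calc _ ≤ 2 * (2 ^ (r + 1) * γ) * (16 *
        (min 1 (Real.exp (γ + 1 / 2 - 2 ^ r * p * γ / 4)) * (p * ((n : ℝ) + G.links.card)))) := by
        refine mul_le_mul h1 ?_ (by positivity) (by positivity)
        gcongr
    _ = 64 * γ * (n + G.links.card) *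
        (2 ^ r * p * min 1 (Real.exp (γ + 1 / 2 - 2 ^ r * p * γ / 4))) := by ring
    _ ≤ 64 * γ * (n + G.links.card) *
        (768 * (2 * (2 ^ r * p) / (1 + 2 * (2 ^ r * p)) - 2 ^ r * p / (1 + 2 ^ r * p))) := by
        gcongr
    _ = _ := by ring

lemma sum_lintegral_roundBound_le (hγ : 1 ≤ γ) (v : Fin n)
    (hv : ∀ u, hitProb G u ≤ hitProb G v) (f : ℕ) :
    ∑ r ∈ Finset.range f, ∫⁻ tape, roundBound G γ v (r + 1) tape ∂G.tapeLaw ≤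
      ENNReal.ofReal (64 * 768 * γ * (n + G.links.card)) := by
  have hp := hitProb_nonneg G v
  refine (Finset.sum_le_sum fun r _ => lintegral_roundBound_succ_le G hγ v hv r).trans ?_
  have h : ∀ r : ℕ, 0 ≤ 64 * 768 * γ * (n + G.links.card) *
      (2 ^ (r + 1) * hitProb G v / (1 + 2 ^ (r + 1) * hitProb G v) -
        2 ^ r * hitProb G v / (1 + 2 ^ r * hitProb G v)) := by
    intro r
    refine mul_nonneg (by positivity) (sub_nonneg.2 ?_)
    rw [div_le_div_iff₀ (by positivity) (by positivity), pow_succ]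
    nlinarith [show 0 ≤ 2 ^ r * hitProb G v by positivity]
  rw [← ENNReal.ofReal_sum_of_nonneg fun r _ => h r, ← Finset.mul_sum,
    Finset.sum_range_sub fun r => 2 ^ r * hitProb G v / (1 + 2 ^ r * hitProb G v)]
  refine ENNReal.ofReal_le_ofReal (mul_le_of_le_one_right (by positivity) ?_)
  have h1 : 2 ^ f * hitProb G v / (1 + 2 ^ f * hitProb G v) ≤ 1 :=
    div_le_one_of_le₀ (by linarith) (by positivity)
  have h2 : 0 ≤ 2 ^ 0 * hitProb G v / (1 + 2 ^ 0 * hitProb G v) := by positivity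
  linarith

lemma expectedRunningTime_le (hk : 1 ≤ k) (hγ : 1 ≤ γ) :
    expectedRunningTime G k γ ≤ ENNReal.ofReal (50000 * γ * (n + G.links.card)) := by
  obtain ⟨v₀, -⟩ := G.exists_critical
  have : Nonempty (Fin n) := ⟨v₀⟩
  have hn : 1 ≤ (n : ℝ) := by exact_mod_cast Fin.pos v₀
  obtain ⟨v, hv⟩ := Finite.exists_max (hitProb G)
  have hsum : ∑' r, ∫⁻ tape, roundBound G γ v r tape ∂G.tapeLaw ≤
      ENNReal.ofReal (64 * 768 * γ * (n + G.links.card)) +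
        ENNReal.ofReal (32 * γ * (n + G.links.card)) := by
    rw [ENNReal.tsum_eq_iSup_nat]
    refine iSup_le fun f => (Finset.sum_le_sum_of_subset
      (Finset.range_subset_range.2 f.le_succ)).trans ?_
    rw [Finset.sum_range_succ']
    exact add_le_add (sum_lintegral_roundBound_le G hγ v hv f)
      (lintegral_roundBound_zero_le G hγ v hv)
  have : IsProbabilityMeasure G.tapeLaw := by
    unfold SocialNetwork.tapeLaw
    infer_instance
  calc expectedRunningTime G k γ
      ≤ ∫⁻ tape, ((n + 1 : ℕ) + ∑' r, roundBound G γ v r tape) ∂G.tapeLaw :=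
        lintegral_mono (runningTime_le G hk v)
    _ = (n + 1 : ℕ) + ∑' r, ∫⁻ tape, roundBound G γ v r tape ∂G.tapeLaw := by
        rw [lintegral_add_left measurable_const, lintegral_const, measure_univ, mul_one,
          lintegral_tsum fun r => (measurable_roundBound G v r).aemeasurable]
    _ ≤ ENNReal.ofReal (n + 1 : ℕ) + (ENNReal.ofReal (64 * 768 * γ * (n + G.links.card)) +
        ENNReal.ofReal (32 * γ * (n + G.links.card))) := by
        rw [ENNReal.ofReal_natCast]
        gcongr
    _ ≤ _ := by
        rw [← ENNReal.ofReal_add (by positivity) (by positivity),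
          ← ENNReal.ofReal_add (by positivity) (by positivity)]
        refine ENNReal.ofReal_le_ofReal ?_
        have h1 : (n : ℝ) + G.links.card ≤ γ * (n + G.links.card) :=
          le_mul_of_one_le_left (by positivity) hγ
        have h2 : (0 : ℝ) ≤ G.links.card := Nat.cast_nonneg _
        push_cast
        nlinarith

end RunningTime

lemma one_le_threshold (n k : ℕ) (ε : ℝ) {δ : ℝ} (h0 : 0 < δ) (h1 : δ < 1) :
    1 ≤ threshold n k ε δ := by
  have h2 : Real.log 2 ≤ Real.log (2 / δ) :=
    Real.log_le_log two_pos ((le_div_iff₀ h0).2 (by linarith))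
  have h3 := Real.log_two_gt_d9
  have h4 := sq_nonneg (phi n k ε δ)
  rw [threshold]
  linarith

end TargetedIM

theorem theorem2 (a : ℝ) :
    ∃ C : ℝ, ∀ (n : ℕ) (G : TargetedIM.SocialNetwork n) (k : ℕ) (ε δ : ℝ),
      1 ≤ k → k ≤ n → 0 < ε → 0 < δ → δ < 1 → (n : ℝ) ≤ a * (G.links.card : ℝ) →
        Measurable (TargetedIM.runningTime G k (TargetedIM.threshold n k ε δ)) ∧
        TargetedIM.expectedRunningTime G k (TargetedIM.threshold n k ε δ) ≤
          ENNReal.ofReal (C * (TargetedIM.threshold n k ε δ * (G.links.card : ℝ))) := by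
  refine ⟨50000 * (a + 1), fun n G k ε δ hk _ _ hδ hδ1 hn =>
    ⟨TargetedIM.measurable_runningTime, ?_⟩⟩
  have hγ := TargetedIM.one_le_threshold n k ε hδ hδ1
  refine (TargetedIM.expectedRunningTime_le G hk hγ).trans (ENNReal.ofReal_le_ofReal ?_)
  calc _ ≤ 50000 * TargetedIM.threshold n k ε δ *
        (a * (G.links.card : ℝ) + G.links.card) := by gcongr
    _ = _ := by ring
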